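/- Let $X$ be a Banach space over $\mathbb{K}=\mathbb{R}$ or $\mathbb{C}$ that is an M-ideal in its bidual, i.e. the canonical decomposition of its third dual is an $\ell_1$-decomposition $X^{***}=X^*\oplus_1 X^\perp$: here $X^*$ is canonically embedded in $X^{***}$, $X^\perp\subseteq X^{***}$ is the annihilator of the canonical copy of $X$ in $X^{**}$, and $\|f+g\|=\|f\|+\|g\|$ for all $f\in X^*$, $g\in X^\perp$. Then $X$ has Pełczyński's property $(V)$: a set $A\subseteq X^*$ is relatively weakly compact whenever $$\lim_{n\to\infty}\ \sup_{x^*\in A}|x^*(x_n)|=0$$ for every sequence $(x_n)$ in $X$ that is weakly unconditionally Cauchy, i.e. satisfies $\sum_{n}|x^*(x_n)|<\infty$ for all $x^*\in X^*$. Moreover (this is an equivalent form of property $(V)$), for every Banach space $Y$ over $\mathbb{K}$, every bounded linear operator $T\colon X\to Y$ that is not weakly compact fixes a copy of $c_0$: there is a subspace $X_0\subseteq X$, isomorphic to $c_0$, such that $T$ restricts to an isomorphism from $X_0$ onto $T(X_0)$. -/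

import Mathlib

set_option maxSynthPendingDepth 3

open NormedSpace Filter Topology
open scoped ZeroAtInfty ENNReal

/-- The canonical copy of `X*` in the third dual `X***`: the range of the evaluation embedding
of `X*` into its own bidual. -/
noncomputable def dualInThirdDual (𝕜 X : Type*) [RCLike 𝕜] [NormedAddCommGroup X]
    [NormedSpace 𝕜 X] :
    Submodule 𝕜 (StrongDual 𝕜 (StrongDual 𝕜 (StrongDual 𝕜 X))) :=
  LinearMap.range (inclusionInDoubleDual 𝕜 (StrongDual 𝕜 X)).toLinearMap

/-- The annihilator `X^⊥` in `X***` of the canonical copy of `X` in `X**`. -/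
def annihilatorInThirdDual (𝕜 X : Type*) [RCLike 𝕜] [NormedAddCommGroup X]
    [NormedSpace 𝕜 X] :
    Submodule 𝕜 (StrongDual 𝕜 (StrongDual 𝕜 (StrongDual 𝕜 X))) where
  carrier := {ψ | ∀ x : X, ψ (inclusionInDoubleDual 𝕜 X x) = 0}
  add_mem' := by
    intro a b ha hb x
    simp [ha x, hb x]
  zero_mem' := by
    intro x
    simp
  smul_mem' := by
    intro c a ha x
    simp [ha x]

/-- `E = U ⊕₁ V`: the normed space `E` is the direct sum of `U` and `V`, and
`‖u + v‖ = ‖u‖ + ‖v‖` for `u ∈ U`, `v ∈ V`. -/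
def IsL1DirectSum {𝕜 E : Type*} [RCLike 𝕜] [NormedAddCommGroup E] [NormedSpace 𝕜 E]
    (U V : Submodule 𝕜 E) : Prop :=
  IsCompl U V ∧ ∀ u ∈ U, ∀ v ∈ V, ‖u + v‖ = ‖u‖ + ‖v‖

/-- `X` is an M-ideal in its bidual: `X*** = X* ⊕₁ X^⊥`. -/
def IsMIdealInBidual (𝕜 X : Type*) [RCLike 𝕜] [NormedAddCommGroup X]
    [NormedSpace 𝕜 X] : Prop :=
  IsL1DirectSum (dualInThirdDual 𝕜 X) (annihilatorInThirdDual 𝕜 X)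

/-- The set `s` is relatively compact for the weak topology of `E`. -/
def IsRelativelyWeaklyCompact (𝕜 : Type*) {E : Type*} [RCLike 𝕜] [NormedAddCommGroup E]
    [NormedSpace 𝕜 E] (s : Set E) : Prop :=
  IsCompact (closure (toWeakSpace 𝕜 E '' s))

/-- The sequence `x` is weakly unconditionally Cauchy: `∑ |f (x n)| < ∞` for all `f ∈ X*`. -/
def IsWeaklyUnconditionallyCauchy (𝕜 : Type*) {X : Type*} [RCLike 𝕜] [NormedAddCommGroup X]
    [NormedSpace 𝕜 X] (x : ℕ → X) : Prop :=
  ∀ f : StrongDual 𝕜 X, Summable fun n => ‖f (x n)‖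

/-- Pełczyński's property (V): a set `A ⊆ X*` is relatively weakly compact as soon as
`sup_{f ∈ A} |f (x n)| → 0` for every weakly unconditionally Cauchy sequence `x` in `X`. -/
def HasPropertyV (𝕜 X : Type*) [RCLike 𝕜] [NormedAddCommGroup X] [NormedSpace 𝕜 X] : Prop :=
  ∀ A : Set (StrongDual 𝕜 X),
    (∀ x : ℕ → X, IsWeaklyUnconditionallyCauchy 𝕜 x →
      Tendsto (fun n => ⨆ f ∈ A, ‖f (x n)‖ₑ) atTop (𝓝 0)) →
    IsRelativelyWeaklyCompact 𝕜 A

/-- The operator `T` is weakly compact: it maps the closed unit ball to a relatively weakly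
compact set. -/
def IsWeaklyCompactOperator {𝕜 X Y : Type*} [RCLike 𝕜] [NormedAddCommGroup X] [NormedSpace 𝕜 X]
    [NormedAddCommGroup Y] [NormedSpace 𝕜 Y] (T : X →L[𝕜] Y) : Prop :=
  IsRelativelyWeaklyCompact 𝕜 (T '' Metric.closedBall 0 1)

/-- The operator `T` fixes a copy of `c₀`: there is a subspace `X₀` of `X`, isomorphic to `c₀`,
such that `T` restricts to an isomorphism from `X₀` onto `T(X₀)`. -/
def FixesCopyOfC0 {𝕜 X Y : Type*} [RCLike 𝕜] [NormedAddCommGroup X] [NormedSpace 𝕜 X]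
    [NormedAddCommGroup Y] [NormedSpace 𝕜 Y] (T : X →L[𝕜] Y) : Prop :=
  ∃ X₀ : Submodule 𝕜 X, Nonempty (C₀(ℕ, 𝕜) ≃L[𝕜] X₀) ∧
    ∃ e : X₀ ≃L[𝕜] X₀.map T.toLinearMap, ∀ x : X₀, (e x : Y) = T x

/-! Both claims reduce to one construction. Let `z` in the open unit ball of `X**` be such that, for
every `u` in `X`, some functional of `B` is at least `δ` on `z - u`. Then `exists_seq` builds `x n`
in `X` whose finite sums with coefficients in the unit disc lie in the unit ball, while `B` reaches
`δ` on each `x n`.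

The M-ideal hypothesis enters in `exists_forall_norm_lt`: a dual obstruction to the norm estimates
splits as `f i + g i`, with `f i` seeing only the centres in `X`, `g i` only `z`, and
`ℓ₁`-additivity of the norm closes the estimate. Helly's lemma then replaces `z - u` by a vector of
`X`, and iterating over compact sets gives the sequence.

For (V), a weak-star cluster point of `A` outside `X*` has a nonzero part in `X^⊥`, which takes the
same value at every `z - u`. For operators, some `T**z` lies at positive distance from `Y`;
Rosenthal's lemma then thins the sequence until `T` is bounded below on its span. -/

/-! ### Duality for finite systems of norm inequalities -/

/-- A point all of whose values at functionals vanishing on `M` are at most `ρ` in norm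
can be moved by `M` to a point of norm less than any `r > ρ`. -/
theorem exists_mem_norm_add_lt {𝕜 F : Type*} [RCLike 𝕜] [NormedAddCommGroup F] [NormedSpace 𝕜 F]
    (M : Submodule 𝕜 F) (a : F) {ρ r : ℝ} (hρ : 0 ≤ ρ) (hr : ρ < r)
    (h : ∀ Φ : StrongDual 𝕜 F, (∀ m ∈ M, Φ m = 0) → ‖Φ a‖ ≤ ρ * ‖Φ‖) :
    ∃ m ∈ M, ‖a + m‖ < r := by
  -- Hahn–Banach in the quotient by `M`, whose seminorm is the distance to `M`.
  obtain ⟨g, hg, hga⟩ := exists_dual_vector'' 𝕜 (M.mkQ a)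
  have hΦ : ‖g ∘L M.mkQL‖ ≤ 1 := by
    refine ContinuousLinearMap.opNorm_le_bound _ zero_le_one fun x => ?_
    calc ‖g (M.mkQ x)‖ ≤ ‖g‖ * ‖M.mkQ x‖ := g.le_opNorm _
      _ ≤ 1 * ‖x‖ := by gcongr; exact Submodule.Quotient.norm_mk_le M x
  have h1 := h (g ∘L M.mkQL) fun m hm => by
    have : M.mkQ m = 0 := by simpa using hm
    show g (M.mkQ m) = 0
    rw [this, map_zero]
  have h2 : ‖M.mkQ a‖ ≤ ρ := by
    have : ‖g (M.mkQ a)‖ ≤ ρ := h1.trans (mul_le_of_le_one_right hρ hΦ)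
    rwa [hga, RCLike.norm_ofReal, abs_norm] at this
  obtain ⟨b, hb, hbn⟩ := Submodule.Quotient.norm_mk_lt (M.mkQ a) (sub_pos.2 hr)
  refine ⟨b - a, ?_, ?_⟩
  · exact (Submodule.Quotient.eq M).1 hb
  · rw [add_sub_cancel]; linarith

/-- The norm of a functional on a finite power dominates the sum of the norms of its components. -/
theorem sum_norm_comp_single_le {𝕜 E ι : Type*} [RCLike 𝕜] [NormedAddCommGroup E]
    [NormedSpace 𝕜 E] [Fintype ι] [DecidableEq ι] (Φ : StrongDual 𝕜 (ι → E)) :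
    ∑ i, ‖Φ ∘L ContinuousLinearMap.single 𝕜 (fun _ => E) i‖ ≤ ‖Φ‖ := by
  refine le_of_forall_pos_le_add fun ε hε => ?_
  set φ : ι → StrongDual 𝕜 E := fun i => Φ ∘L ContinuousLinearMap.single 𝕜 (fun _ => E) i
  set η : ℝ := ε / (Fintype.card ι + 1)
  have hη : 0 < η := by positivity
  -- Almost norming vectors, rotated so that the values are nonnegative and add up without
  -- cancellation.
  have key : ∀ i, ∃ b : E, ‖b‖ ≤ 1 ∧ ((‖φ i b‖ : ℝ) : 𝕜) = φ i b ∧ ‖φ i‖ - η ≤ ‖φ i b‖ := by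
    intro i
    rcases le_or_gt (‖φ i‖ - η) 0 with h0 | h0
    · exact ⟨0, by simp, by simp, by simpa using h0⟩
    obtain ⟨b, hb, hφb⟩ := ContinuousLinearMap.exists_lt_apply_of_lt_opNorm (φ i)
      (show ‖φ i‖ - η < ‖φ i‖ by linarith)
    have hne : φ i b ≠ 0 := fun h => by rw [h, norm_zero] at hφb; linarith
    obtain ⟨c, hc, hcb⟩ := RCLike.exists_norm_eq_mul_self (φ i b)
    refine ⟨c • b, ?_, ?_, ?_⟩
    · rw [norm_smul, hc, one_mul]; exact hb.le
    · rw [map_smul, norm_smul, hc, one_mul, hcb, smul_eq_mul]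
    · rw [map_smul, norm_smul, hc, one_mul]; exact hφb.le
  choose b hb1 hb2 hb3 using key
  have hsum : Φ b = ∑ i, φ i (b i) := by
    conv_lhs => rw [← Finset.univ_sum_single b]
    simp [φ]
  have h1 : ∑ i, ‖φ i (b i)‖ ≤ ‖Φ‖ := by
    have h2 : Φ b = ((∑ i, ‖φ i (b i)‖ : ℝ) : 𝕜) := by
      rw [hsum]; push_cast; exact Finset.sum_congr rfl fun i _ => (hb2 i).symm
    have h3 : ‖Φ b‖ = ∑ i, ‖φ i (b i)‖ := by
      rw [h2, RCLike.norm_ofReal, abs_of_nonneg (Finset.sum_nonneg fun i _ => norm_nonneg _)]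
    rw [← h3]
    exact Φ.unit_le_opNorm b ((pi_norm_le_iff_of_nonneg zero_le_one).2 hb1)
  have h4 : ∑ i, ‖φ i‖ - (Fintype.card ι) * η ≤ ∑ i, ‖φ i (b i)‖ := by
    calc _ = ∑ i, (‖φ i‖ - η) := by simp [Finset.sum_sub_distrib]
      _ ≤ _ := Finset.sum_le_sum fun i _ => hb3 i
  have h5 : (Fintype.card ι) * η ≤ ε := by
    simp only [η]
    rw [← mul_div_assoc, div_le_iff₀ (by positivity)]
    nlinarith
  linarith

/-- A finite family of affine constraints `‖a i + l i • u‖ < r` with `u ∈ S` is solvable as soon as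
the dual condition holds. -/
theorem exists_mem_forall_norm_add_smul_lt {𝕜 E ι : Type*} [RCLike 𝕜] [NormedAddCommGroup E]
    [NormedSpace 𝕜 E] [Fintype ι] (S : Submodule 𝕜 E) (a : ι → E) (l : ι → 𝕜)
    {ρ r : ℝ} (hρ : 0 ≤ ρ) (hr : ρ < r)
    (h : ∀ φ : ι → StrongDual 𝕜 E, (∀ u ∈ S, (∑ i, l i • φ i) u = 0) →
      ‖∑ i, φ i (a i)‖ ≤ ρ * ∑ i, ‖φ i‖) :
    ∃ u ∈ S, ∀ i, ‖a i + l i • u‖ < r := by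
  classical
  -- All constraints become one in the sup-normed power of `E`, with `S` embedded by `u ↦ (l i •
  -- u)`.
  obtain ⟨m, hm, hlt⟩ := exists_mem_norm_add_lt
    (S.map (LinearMap.pi fun i => l i • LinearMap.id : E →ₗ[𝕜] ι → E)) a hρ hr (fun Φ hΦ => by
      have hsum : ∀ b : ι → E, Φ b
          = ∑ i, (Φ ∘L ContinuousLinearMap.single 𝕜 (fun _ => E) i) (b i) := fun b => by
        conv_lhs => rw [← Finset.univ_sum_single b]
        simp
      rw [hsum]
      refine (h (fun i => Φ ∘L ContinuousLinearMap.single 𝕜 (fun _ => E) i) ?_).trans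
        (mul_le_mul_of_nonneg_left (sum_norm_comp_single_le Φ) hρ)
      intro u hu
      rw [← hΦ _ (Submodule.mem_map_of_mem hu), hsum]
      simp only [sum_apply, smul_apply,
        LinearMap.pi_apply, LinearMap.smul_apply, LinearMap.id_apply, map_smul])
  obtain ⟨u, hu, rfl⟩ := hm
  refine ⟨u, hu, fun i => lt_of_le_of_lt ?_ hlt⟩
  exact norm_le_pi_norm (a + (LinearMap.pi fun i => l i • LinearMap.id : E →ₗ[𝕜] ι → E) u) i

/-! ### From the M-ideal condition to vectors of `X` -/

/-- If `X` is an M-ideal in its bidual, then finitely many balls of `X**` centred in `X` can be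
met by a translate by `X` of a bidual element. -/
theorem IsMIdealInBidual.exists_forall_norm_lt {𝕜 X ι : Type*} [RCLike 𝕜] [NormedAddCommGroup X]
    [NormedSpace 𝕜 X] [Fintype ι] (hX : IsMIdealInBidual 𝕜 X)
    (z : StrongDual 𝕜 (StrongDual 𝕜 X)) (e : ι → X) (l : ι → 𝕜) {ρ r : ℝ} (hρ : 0 ≤ ρ)
    (hr : ρ < r) (he : ∀ i, ‖e i‖ ≤ ρ) (hl : ∀ i, ‖l i‖ * ‖z‖ ≤ ρ) :
    ∃ u : X, ∀ i, ‖inclusionInDoubleDual 𝕜 X (e i)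
      + l i • (z - inclusionInDoubleDual 𝕜 X u)‖ < r := by
  obtain ⟨hcompl, hnorm⟩ := hX
  have key := exists_mem_forall_norm_add_smul_lt
    (LinearMap.range (inclusionInDoubleDual 𝕜 X).toLinearMap)
    (fun i => inclusionInDoubleDual 𝕜 X (e i) + l i • z) l hρ hr ?_
  · obtain ⟨_, ⟨u, rfl⟩, hu⟩ := key
    refine ⟨-u, fun i => ?_⟩
    refine lt_of_eq_of_lt (congrArg norm ?_) (hu i)
    simp [smul_add, add_assoc]
  intro φ hφ
  have hdec : ∀ i, ∃ f : StrongDual 𝕜 X, ∃ g ∈ annihilatorInThirdDual 𝕜 X,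
      inclusionInDoubleDual 𝕜 (StrongDual 𝕜 X) f + g = φ i := fun i => by
    obtain ⟨_, ⟨f, rfl⟩, g, hg, hfg⟩ := Submodule.mem_sup.1
      (hcompl.sup_eq_top ▸ Submodule.mem_top : φ i ∈ dualInThirdDual 𝕜 X ⊔ annihilatorInThirdDual 𝕜 X)
    exact ⟨f, g, hg, hfg⟩
  choose f g hg hfg using hdec
  -- The `g i` vanish on `X`, so the relation between the `φ i` passes to the `f i`; this removes
  -- the terms `l i * z (f i)` below.
  have hf0 : ∑ i, l i • f i = 0 := by
    ext x
    have h1 := hφ _ ⟨x, rfl⟩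
    simp only [← hfg, sum_apply, smul_apply,
      add_apply, ContinuousLinearMap.coe_coe, dual_def] at h1
    simp only [fun i => hg i x, add_zero] at h1
    simpa using h1
  have hval : ∑ i, φ i (inclusionInDoubleDual 𝕜 X (e i) + l i • z)
      = ∑ i, (f i (e i) + l i * g i z) := by
    have hz : ∑ i, l i * z (f i) = 0 := by
      have := congrArg z hf0
      simpa using this
    calc _ = ∑ i, (f i (e i) + l i * g i z + l i * z (f i)) := by
          refine Finset.sum_congr rfl fun i _ => ?_
          rw [← hfg]
          simp only [add_apply, map_add, map_smul, dual_def, smul_eq_mul]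
          rw [hg i (e i)]
          ring
      _ = _ := by rw [Finset.sum_add_distrib, hz, add_zero]
  rw [hval, Finset.mul_sum]
  refine (norm_sum_le _ _).trans (Finset.sum_le_sum fun i _ => ?_)
  have hn : ‖φ i‖ = ‖f i‖ + ‖g i‖ := by
    rw [← hfg]
    refine (hnorm _ ⟨f i, rfl⟩ _ (hg i)).trans ?_
    congr 1
    exact (inclusionInDoubleDualLi (E := StrongDual 𝕜 X) 𝕜).norm_map (f i)
  calc ‖f i (e i) + l i * g i z‖ ≤ ‖f i (e i)‖ + ‖l i‖ * ‖g i z‖ := by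
        rw [← norm_mul]; exact norm_add_le _ _
    _ ≤ ‖f i‖ * ‖e i‖ + ‖l i‖ * (‖g i‖ * ‖z‖) := by
        gcongr
        · exact (f i).le_opNorm _
        · exact (g i).le_opNorm _
    _ = ‖f i‖ * ‖e i‖ + ‖g i‖ * (‖l i‖ * ‖z‖) := by ring
    _ ≤ ‖f i‖ * ρ + ‖g i‖ * ρ := by gcongr; exacts [he i, hl i]
    _ = ρ * ‖φ i‖ := by rw [hn]; ring

/-- **Helly's lemma**: a bidual element can be replaced by an element of `X` with the same value at
a given functional while finitely many norm estimates are kept. -/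
theorem exists_apply_eq_forall_norm_lt {𝕜 X ι : Type*} [RCLike 𝕜] [NormedAddCommGroup X]
    [NormedSpace 𝕜 X] [Fintype ι] (z : StrongDual 𝕜 (StrongDual 𝕜 X)) (f : StrongDual 𝕜 X)
    (e : ι → X) (l : ι → 𝕜) {ρ r : ℝ} (hρ : 0 ≤ ρ) (hr : ρ < r)
    (he : ∀ i, ‖inclusionInDoubleDual 𝕜 X (e i) + l i • z‖ ≤ ρ) :
    ∃ v : X, f v = z f ∧ ∀ i, ‖e i + l i • v‖ < r := by
  obtain ⟨w, hw⟩ : ∃ w : X, f w = z f := by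
    by_cases hf : f = 0
    · exact ⟨0, by simp [hf]⟩
    obtain ⟨x, hx⟩ : ∃ x, f x ≠ 0 := by
      by_contra! h
      exact hf (ContinuousLinearMap.ext h)
    exact ⟨(z f / f x) • x, by simp [hx]⟩
  obtain ⟨u, hu, hlt⟩ := exists_mem_forall_norm_add_smul_lt (LinearMap.ker f.toLinearMap)
    (fun i => e i + l i • w) l hρ hr fun φ hφ => by
      -- A functional vanishing on `ker f` is a multiple of `f`, hence cannot tell `w` from `z`.
      obtain ⟨c, hc⟩ : ∃ c : 𝕜, ∑ i, l i • φ i = c • f := by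
        by_cases hf : f = 0
        · refine ⟨0, ContinuousLinearMap.ext fun x => ?_⟩
          rw [hφ x (by simp [hf])]; simp
        obtain ⟨x, hx⟩ : ∃ x, f x ≠ 0 := by
          by_contra! h
          exact hf (ContinuousLinearMap.ext h)
        refine ⟨(∑ i, l i • φ i) x / f x, ContinuousLinearMap.ext fun y => ?_⟩
        have := hφ (y - (f y / f x) • x) (by simp [hx])
        rw [map_sub, map_smul, sub_eq_zero] at this
        rw [this, smul_apply, smul_eq_mul, smul_eq_mul]
        ring
      have hval : ∑ i, φ i (e i + l i • w)
          = ∑ i, (inclusionInDoubleDual 𝕜 X (e i) + l i • z) (φ i) := by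
        have h1 : ∑ i, l i * φ i w = ∑ i, l i * z (φ i) := by
          calc ∑ i, l i * φ i w = (∑ i, l i • φ i) w := by simp
            _ = z (∑ i, l i • φ i) := by rw [hc]; simp [hw]
            _ = _ := by simp
        simp only [map_add, map_smul, smul_eq_mul, Finset.sum_add_distrib, h1,
          add_apply, smul_apply, dual_def]
      rw [hval, Finset.mul_sum]
      exact (norm_sum_le _ _).trans (Finset.sum_le_sum fun i _ =>
        ContinuousLinearMap.le_of_opNorm_le _ (he i) _)
  refine ⟨w + u, ?_, fun i => ?_⟩
  · rw [map_add, hw, show f u = 0 from hu, add_zero]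
  · rw [smul_add, ← add_assoc]; exact hlt i

/-- The extension step: a compact subset of the open unit ball of `X` can be enlarged in the
direction of some `v` on which a functional of `B` is large. -/
theorem IsMIdealInBidual.exists_compact_extension {𝕜 X : Type*} [RCLike 𝕜] [NormedAddCommGroup X]
    [NormedSpace 𝕜 X] (hX : IsMIdealInBidual 𝕜 X) {z : StrongDual 𝕜 (StrongDual 𝕜 X)}
    (hz : ‖z‖ < 1) {B : Set (StrongDual 𝕜 X)} {δ : ℝ}
    (hB : ∀ u : X, ∃ b ∈ B, δ ≤ ‖(z - inclusionInDoubleDual 𝕜 X u) b‖)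
    {K : Set X} (hK : IsCompact K) (hK1 : ∀ e ∈ K, ‖e‖ < 1) :
    ∃ v : X, ∃ b ∈ B, δ ≤ ‖b v‖ ∧ ∀ e ∈ K, ∀ c : 𝕜, ‖c‖ ≤ 1 → ‖e + c • v‖ < 1 := by
  obtain ⟨ρ, hρ0, hρ1, hzρ, hKρ⟩ : ∃ ρ : ℝ, 0 ≤ ρ ∧ ρ < 1 ∧ ‖z‖ ≤ ρ ∧ ∀ e ∈ K, ‖e‖ ≤ ρ := by
    rcases K.eq_empty_or_nonempty with rfl | hne
    · exact ⟨‖z‖, norm_nonneg _, hz, le_rfl, by simp⟩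
    obtain ⟨m, hm, hmax⟩ := hK.exists_isMaxOn hne continuous_norm.continuousOn
    exact ⟨max ‖z‖ ‖m‖, (norm_nonneg _).trans (le_max_left _ _), max_lt hz (hK1 m hm),
      le_max_left _ _, fun e he => (hmax he).trans (le_max_right _ _)⟩
  -- One `η` each for the M-ideal step, Helly's lemma, the error in `e` and the error in `c`.
  set η : ℝ := (1 - ρ) / 4
  have hη : 0 < η := by simp only [η]; linarith
  have hη4 : ρ + 4 * η = 1 := by simp only [η]; ring
  obtain ⟨t, htK, htfin, htcov⟩ := (hK.prod (isCompact_closedBall (0 : 𝕜) 1)).finite_cover_balls hη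
  -- The extra pair `(0, 1)` bounds `‖v‖` itself, which controls the error in `c`.
  have hfin : (insert ((0 : X), (1 : 𝕜)) t).Finite := htfin.insert _
  have : Fintype ↥(insert ((0 : X), (1 : 𝕜)) t) := hfin.fintype
  have hmem : ∀ i : ↥(insert ((0 : X), (1 : 𝕜)) t), ‖i.1.1‖ ≤ ρ ∧ ‖i.1.2‖ ≤ 1 := by
    rintro ⟨i, rfl | hi⟩
    · simpa using hρ0
    · have := htK hi
      exact ⟨hKρ _ this.1, by simpa using this.2⟩
  obtain ⟨u, hu⟩ := hX.exists_forall_norm_lt z (fun i : ↥(insert ((0 : X), (1 : 𝕜)) t) => i.1.1)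
    (fun i => i.1.2) hρ0 (show ρ < ρ + η by linarith) (fun i => (hmem i).1)
    (fun i => (mul_le_of_le_one_left (norm_nonneg _) (hmem i).2).trans hzρ)
  obtain ⟨b, hbB, hb⟩ := hB u
  obtain ⟨v, hvb, hv⟩ := exists_apply_eq_forall_norm_lt (z - inclusionInDoubleDual 𝕜 X u) b
    (fun i : ↥(insert ((0 : X), (1 : 𝕜)) t) => i.1.1) (fun i => i.1.2) (by linarith)
    (show ρ + η < ρ + 2 * η by linarith) (fun i => (hu i).le)
  refine ⟨v, b, hbB, by rwa [hvb], fun e he c hc => ?_⟩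
  have hv1 : ‖v‖ < ρ + 2 * η := by simpa using hv ⟨_, Set.mem_insert _ _⟩
  obtain ⟨⟨e', c'⟩, hi, hd⟩ := Set.mem_iUnion₂.1
    (htcov (show (e, c) ∈ K ×ˢ Metric.closedBall (0 : 𝕜) 1 from ⟨he, by simpa using hc⟩))
  rw [Metric.mem_ball, Prod.dist_eq, max_lt_iff, dist_eq_norm, dist_eq_norm] at hd
  have h1 : ‖e' + c' • v‖ < ρ + 2 * η := hv ⟨_, Set.mem_insert_of_mem _ hi⟩
  have h2 : e + c • v = (e' + c' • v) + ((e - e') + (c - c') • v) := by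
    rw [sub_smul]; abel
  have h3 : ‖(c - c') • v‖ ≤ η := by
    rw [norm_smul]
    calc ‖c - c'‖ * ‖v‖ ≤ η * 1 := by
          gcongr
          · exact hd.2.le
          · linarith
      _ = η := mul_one η
  rw [h2]
  calc _ ≤ ‖e' + c' • v‖ + (‖e - e'‖ + ‖(c - c') • v‖) :=
        (norm_add_le _ _).trans (by gcongr; exact norm_add_le _ _)
    _ < 1 := by linarith [hd.1]

/-! ### Sequences with bounded unconditional sums -/

/-- The sums of `x` with finitely many coefficients in the unit disc stay in the unit ball. -/
def HasBoundedUnconditionalSums (𝕜 : Type*) {X : Type*} [RCLike 𝕜] [NormedAddCommGroup X]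
    [NormedSpace 𝕜 X] (x : ℕ → X) : Prop :=
  ∀ (F : Finset ℕ) (θ : ℕ → 𝕜), (∀ i, ‖θ i‖ ≤ 1) → ‖∑ i ∈ F, θ i • x i‖ ≤ 1

/-- If a bidual element of an M-ideal `X` stays away from `X` when tested against `B`, then `B` is
large on a sequence with bounded unconditional sums. -/
theorem IsMIdealInBidual.exists_seq {𝕜 X : Type*} [RCLike 𝕜] [NormedAddCommGroup X]
    [NormedSpace 𝕜 X] (hX : IsMIdealInBidual 𝕜 X) {z : StrongDual 𝕜 (StrongDual 𝕜 X)}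
    (hz : ‖z‖ < 1) {B : Set (StrongDual 𝕜 X)} {δ : ℝ}
    (hB : ∀ u : X, ∃ b ∈ B, δ ≤ ‖(z - inclusionInDoubleDual 𝕜 X u) b‖) :
    ∃ x : ℕ → X, HasBoundedUnconditionalSums 𝕜 x ∧ ∀ n, ∃ b ∈ B, δ ≤ ‖b (x n)‖ := by
  have step : ∀ K : {K : Set X // IsCompact K ∧ ∀ e ∈ K, ‖e‖ < 1},
      ∃ v : X, (∃ b ∈ B, δ ≤ ‖b v‖) ∧ ∀ e ∈ K.1, ∀ c : 𝕜, ‖c‖ ≤ 1 → ‖e + c • v‖ < 1 := by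
    rintro ⟨K, hK, hK1⟩
    obtain ⟨v, b, hb, hbv, hv⟩ := hX.exists_compact_extension hz hB hK hK1
    exact ⟨v, ⟨b, hb, hbv⟩, hv⟩
  choose v hvB hv using step
  -- The iterates contain all partial sums with coefficients in the unit disc.
  let next : {K : Set X // IsCompact K ∧ ∀ e ∈ K, ‖e‖ < 1} →
      {K : Set X // IsCompact K ∧ ∀ e ∈ K, ‖e‖ < 1} := fun K =>
    ⟨(fun p : X × 𝕜 => p.1 + p.2 • v K) '' (K.1 ×ˢ Metric.closedBall 0 1),
      (K.2.1.prod (isCompact_closedBall _ _)).image (by fun_prop), by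
        rintro _ ⟨⟨e, c⟩, ⟨he, hc⟩, rfl⟩
        exact hv K e he c (by simpa using hc)⟩
  let K0 : {K : Set X // IsCompact K ∧ ∀ e ∈ K, ‖e‖ < 1} :=
    ⟨{0}, isCompact_singleton, by simp⟩
  have hsum : ∀ (θ : ℕ → 𝕜), (∀ i, ‖θ i‖ ≤ 1) → ∀ n,
      ∑ i ∈ Finset.range n, θ i • v (next^[i] K0) ∈ (next^[n] K0).1 := by
    intro θ hθ n
    induction n with
    | zero => exact rfl
    | succ n ih =>
      rw [Finset.sum_range_succ, Function.iterate_succ_apply']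
      exact ⟨(_, θ n), ⟨ih, by simpa using hθ n⟩, rfl⟩
  refine ⟨fun n => v (next^[n] K0), fun F θ hθ => ?_, fun n => hvB _⟩
  classical
  have hF : F ⊆ Finset.range (F.sup id + 1) := fun i hi =>
    Finset.mem_range.2 (Nat.lt_succ_of_le (Finset.le_sup (f := id) hi))
  have h1 := hsum (fun i => if i ∈ F then θ i else 0) (fun i => by
    split_ifs
    · exact hθ i
    · simp) (F.sup id + 1)
  have h2 := ((next^[F.sup id + 1] K0).2.2 _ h1).le
  simpa only [ite_smul, zero_smul, Finset.sum_ite_mem, Finset.inter_eq_right.2 hF] using h2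

theorem HasBoundedUnconditionalSums.comp {𝕜 X : Type*} [RCLike 𝕜] [NormedAddCommGroup X]
    [NormedSpace 𝕜 X] {x : ℕ → X} (hx : HasBoundedUnconditionalSums 𝕜 x) {φ : ℕ → ℕ}
    (hφ : Function.Injective φ) : HasBoundedUnconditionalSums 𝕜 (x ∘ φ) := by
  intro F θ hθ
  have := hx (F.map ⟨φ, hφ⟩) (θ ∘ Function.invFun φ) fun i => hθ _
  simpa [Function.leftInverse_invFun hφ _] using this

theorem HasBoundedUnconditionalSums.norm_sum_le {𝕜 X : Type*} [RCLike 𝕜] [NormedAddCommGroup X]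
    [NormedSpace 𝕜 X] {x : ℕ → X} (hx : HasBoundedUnconditionalSums 𝕜 x) (F : Finset ℕ)
    {θ : ℕ → 𝕜} {C : ℝ} (hC : 0 ≤ C) (hθ : ∀ i ∈ F, ‖θ i‖ ≤ C) : ‖∑ i ∈ F, θ i • x i‖ ≤ C := by
  classical
  rcases hC.eq_or_lt with rfl | hC
  · rw [Finset.sum_eq_zero fun i hi => by rw [norm_le_zero_iff.1 (hθ i hi), zero_smul], norm_zero]
  have h1 := hx F (fun i => if i ∈ F then (C : 𝕜)⁻¹ * θ i else 0) fun i => by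
    split_ifs with hi
    · rw [norm_mul, norm_inv, RCLike.norm_ofReal, abs_of_pos hC, inv_mul_le_iff₀ hC, mul_one]
      exact hθ i hi
    · simp
  have h2 : ∑ i ∈ F, (if i ∈ F then (C : 𝕜)⁻¹ * θ i else 0) • x i
      = (C : 𝕜)⁻¹ • ∑ i ∈ F, θ i • x i := by
    rw [Finset.smul_sum]
    exact Finset.sum_congr rfl fun i hi => by rw [if_pos hi, mul_smul]
  rwa [h2, norm_smul, norm_inv, RCLike.norm_ofReal, abs_of_pos hC, inv_mul_le_iff₀ hC,
    mul_one] at h1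

theorem HasBoundedUnconditionalSums.sum_norm_apply_le {𝕜 X : Type*} [RCLike 𝕜]
    [NormedAddCommGroup X] [NormedSpace 𝕜 X] {x : ℕ → X} (hx : HasBoundedUnconditionalSums 𝕜 x)
    (f : StrongDual 𝕜 X) (F : Finset ℕ) : ∑ i ∈ F, ‖f (x i)‖ ≤ ‖f‖ := by
  choose c hc hcf using fun i => RCLike.exists_norm_eq_mul_self (f (x i))
  have h1 : ((∑ i ∈ F, ‖f (x i)‖ : ℝ) : 𝕜) = f (∑ i ∈ F, c i • x i) := by
    simp [hcf]
  have h2 : ‖f (∑ i ∈ F, c i • x i)‖ ≤ ‖f‖ :=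
    f.unit_le_opNorm _ (hx F c fun i => (hc i).le)
  rwa [← h1, RCLike.norm_ofReal,
    abs_of_nonneg (Finset.sum_nonneg fun i _ => norm_nonneg _)] at h2

theorem HasBoundedUnconditionalSums.isWeaklyUnconditionallyCauchy {𝕜 X : Type*} [RCLike 𝕜]
    [NormedAddCommGroup X] [NormedSpace 𝕜 X] {x : ℕ → X}
    (hx : HasBoundedUnconditionalSums 𝕜 x) : IsWeaklyUnconditionallyCauchy 𝕜 x := fun f =>
  summable_of_sum_le (fun _ => norm_nonneg _) (hx.sum_norm_apply_le f)

/-- A sequence with bounded unconditional sums in a Banach space induces a contraction on `c₀`. -/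
theorem HasBoundedUnconditionalSums.exists_clm {𝕜 X : Type*} [RCLike 𝕜] [NormedAddCommGroup X]
    [NormedSpace 𝕜 X] [CompleteSpace X] {x : ℕ → X} (hx : HasBoundedUnconditionalSums 𝕜 x) :
    ∃ S : C₀(ℕ, 𝕜) →L[𝕜] X, (∀ c, HasSum (fun n => c n • x n) (S c)) ∧ ∀ c, ‖S c‖ ≤ ‖c‖ := by
  have hle : ∀ (c : C₀(ℕ, 𝕜)) n, ‖c n‖ ≤ ‖c‖ := fun c n => c.toBCF.norm_coe_le_norm n
  have hsum : ∀ c : C₀(ℕ, 𝕜), Summable fun n => c n • x n := by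
    intro c
    rw [summable_iff_vanishing_norm]
    intro ε hε
    have hc : Tendsto c cofinite (𝓝 0) := by
      rw [← cocompact_eq_cofinite ℕ]; exact c.zero_at_infty'
    have hfin : {n | ¬ ‖c n‖ < ε / 2}.Finite := by
      have := hc.eventually (Metric.ball_mem_nhds 0 (half_pos hε))
      simpa using this
    refine ⟨hfin.toFinset, fun t ht => ?_⟩
    refine (hx.norm_sum_le t (half_pos hε).le fun i hi => ?_).trans_lt (half_lt_self hε)
    have := Finset.disjoint_left.1 ht hi
    rw [Set.Finite.mem_toFinset] at this
    exact (not_not.1 this).le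
  have hbound : ∀ c : C₀(ℕ, 𝕜), ‖∑' n, c n • x n‖ ≤ ‖c‖ := fun c =>
    le_of_tendsto' (hsum c).hasSum.norm fun F =>
      hx.norm_sum_le F (norm_nonneg c) fun i _ => hle c i
  let L : C₀(ℕ, 𝕜) →ₗ[𝕜] X :=
    { toFun := fun c => ∑' n, c n • x n
      map_add' := fun c d => by
        rw [← (hsum c).tsum_add (hsum d)]
        exact tsum_congr fun n => add_smul _ _ _
      map_smul' := fun k c => by
        rw [RingHom.id_apply, ← (hsum c).tsum_const_smul]
        exact tsum_congr fun n => mul_smul _ _ _ }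
  exact ⟨L.mkContinuous 1 fun c => by rw [one_mul]; exact hbound c,
    fun c => (hsum c).hasSum, hbound⟩

/-! ### Fixing a copy of `c₀` -/

/-- **Rosenthal's lemma**: a nonnegative matrix with uniformly bounded row sums has an infinite
principal submatrix with small off-diagonal row sums. -/
theorem exists_injective_tsum_offDiag_le {ε : ℝ≥0∞} (hε : ε ≠ ∞) (k : ℕ) (a : ℕ → ℕ → ℝ≥0∞)
    (h : ∀ m, ∑' n, a m n ≤ k * ε) :
    ∃ φ : ℕ → ℕ, Function.Injective φ ∧
      ∀ m, ∑' n, (if n = m then 0 else a (φ m) (φ n)) ≤ ε := by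
  induction k generalizing a with
  | zero =>
    refine ⟨id, Function.injective_id, fun m => ?_⟩
    refine (ENNReal.tsum_le_tsum fun n => ?_).trans ((h m).trans (by simp))
    split_ifs
    · exact zero_le
    · exact le_rfl
  | succ k ih =>
    -- `Nat.pair` cuts `ℕ` into infinitely many infinite blocks. If no block works, each block `p`
    -- has a bad row `j p`; keeping only these representatives drops more than `ε` from each row
    -- sum, so `k` decreases.
    by_cases H : ∃ p, ∀ j,
        ∑' j', (if j' = j then 0 else a (Nat.pair p j) (Nat.pair p j')) ≤ ε
    · obtain ⟨p, hp⟩ := H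
      exact ⟨Nat.pair p, fun i j hij => (Nat.pair_eq_pair.1 hij).2, hp⟩
    push Not at H
    choose j hj using H
    have hκ : Function.Injective fun p => Nat.pair p (j p) :=
      fun p q hpq => (Nat.pair_eq_pair.1 hpq).1
    obtain ⟨φ, hφ, hφa⟩ := ih (fun m n => a (Nat.pair m (j m)) (Nat.pair n (j n))) fun m => by
      set g : ℕ → ℝ≥0∞ := a (Nat.pair m (j m))
      set s : ℝ≥0∞ := ∑' j', (if j' = j m then 0 else g (Nat.pair m j'))
      have h1 : ∑' n, g n = ∑' p, ∑' i, g (Nat.pair p i) :=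
        (Nat.pairEquiv.tsum_eq g).symm.trans (ENNReal.tsum_prod (f := fun p i => g (Nat.pair p i)))
      have h2 : ∑' n, g (Nat.pair n (j n)) + s ≤ ∑' n, g n := by
        have h3 : s = ∑' n, (if n = m then s else 0) := (tsum_ite_eq m fun _ => s).symm
        rw [h1, h3, ← ENNReal.tsum_add]
        refine ENNReal.tsum_le_tsum fun p => ?_
        split_ifs with hp
        · subst hp
          rw [ENNReal.tsum_eq_add_tsum_ite (f := fun i => g (Nat.pair p i)) (j p)]
          exact add_le_add le_rfl
            (ENNReal.tsum_le_tsum fun i => le_of_eq (by split_ifs <;> rfl))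
        · rw [add_zero]
          exact ENNReal.le_tsum (f := fun i => g (Nat.pair p i)) (j p)
      have h4 : ∑' n, g (Nat.pair n (j n)) + ε ≤ k * ε + ε := by
        calc _ ≤ ∑' n, g (Nat.pair n (j n)) + s := by gcongr; exact (hj m).le
          _ ≤ _ := h2
          _ ≤ ((k + 1 : ℕ) : ℝ≥0∞) * ε := h _
          _ = k * ε + ε := by push_cast; ring
      exact (ENNReal.add_le_add_iff_right hε).1 h4
    exact ⟨_, hκ.comp hφ, hφa⟩

/-- If `T ∘ S` is bounded below for an operator `S` on `c₀`, then `T` fixes a copy of `c₀`. -/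
theorem FixesCopyOfC0.of_bounded_below {𝕜 X Y : Type*} [RCLike 𝕜] [NormedAddCommGroup X]
    [NormedSpace 𝕜 X] [NormedAddCommGroup Y] [NormedSpace 𝕜 Y] (T : X →L[𝕜] Y)
    (S : C₀(ℕ, 𝕜) →L[𝕜] X) {κ : ℝ} (hκ : 0 < κ) (h : ∀ c, κ * ‖c‖ ≤ ‖T (S c)‖) :
    FixesCopyOfC0 T := by
  have hS : Function.Injective S.toLinearMap := by
    rw [injective_iff_map_eq_zero]
    intro c hc
    have := h c
    rw [show S c = 0 from hc, map_zero, norm_zero] at this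
    exact norm_le_zero_iff.1 (nonpos_of_mul_nonpos_right this hκ)
  have hT : ∀ x ∈ LinearMap.range S.toLinearMap, ‖x‖ ≤ ‖S‖ / κ * ‖T x‖ := by
    rintro _ ⟨c, rfl⟩
    calc ‖S c‖ ≤ ‖S‖ * ‖c‖ := S.le_opNorm c
      _ ≤ ‖S‖ * (‖T (S c)‖ / κ) := by
          gcongr; rw [le_div_iff₀ hκ, mul_comm]; exact h c
      _ = ‖S‖ / κ * ‖T (S c)‖ := by ring
  refine ⟨LinearMap.range S.toLinearMap,
    ⟨(LinearEquiv.ofInjective S.toLinearMap hS).toContinuousLinearEquivOfBounds ‖S‖ (‖T‖ / κ)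
      (fun c => S.le_opNorm c) ?_⟩, ?_⟩
  · rintro ⟨_, c, rfl⟩
    have h1 : (LinearEquiv.ofInjective S.toLinearMap hS).symm ⟨S c, c, rfl⟩ = c := by
      rw [LinearEquiv.symm_apply_eq]; rfl
    rw [show (LinearEquiv.ofInjective S.toLinearMap hS).symm
      ⟨(S.toLinearMap : C₀(ℕ, 𝕜) → X) c, c, rfl⟩ = c from h1]
    rw [div_mul_eq_mul_div, le_div_iff₀ hκ, mul_comm]
    exact (h c).trans (T.le_opNorm _)
  · have hinj : Function.Injective (T.toLinearMap.submoduleMap (LinearMap.range S.toLinearMap)) := by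
      rw [injective_iff_map_eq_zero]
      rintro ⟨x, hx⟩ hx0
      have h0 : T x = 0 := congrArg Subtype.val hx0
      have := hT x hx
      rw [h0, norm_zero, mul_zero] at this
      exact Subtype.ext (norm_le_zero_iff.1 this)
    let e := LinearEquiv.ofBijective (T.toLinearMap.submoduleMap (LinearMap.range S.toLinearMap))
      ⟨hinj, T.toLinearMap.submoduleMap_surjective _⟩
    refine ⟨e.toContinuousLinearEquivOfBounds ‖T‖ (‖S‖ / κ) (fun x => T.le_opNorm x) fun y => ?_,
      fun x => rfl⟩
    obtain ⟨x, rfl⟩ := e.surjective y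
    rw [e.symm_apply_apply]
    exact hT x x.2

/-- An operator that does not send a sequence with bounded unconditional sums to zero fixes a copy
of `c₀`. -/
theorem HasBoundedUnconditionalSums.fixesCopyOfC0 {𝕜 X Y : Type*} [RCLike 𝕜]
    [NormedAddCommGroup X] [NormedSpace 𝕜 X] [CompleteSpace X] [NormedAddCommGroup Y]
    [NormedSpace 𝕜 Y] {x : ℕ → X} (hx : HasBoundedUnconditionalSums 𝕜 x) (T : X →L[𝕜] Y) {δ : ℝ}
    (hδ : 0 < δ) (hT : ∀ n, δ ≤ ‖T (x n)‖) : FixesCopyOfC0 T := by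
  -- The matrix `‖g m (T (x n))‖` has row sums at most `‖T‖` and diagonal at least `δ`; off-diagonal
  -- sums below `δ / 2` let the diagonal dominate.
  choose g hg hgT using fun n => exists_dual_vector'' 𝕜 (T (x n))
  have hrow : ∀ m, ∑' n, ‖g m (T (x n))‖ₑ
      ≤ (⌈‖T‖ / (δ / 2)⌉₊ : ℝ≥0∞) * ENNReal.ofReal (δ / 2) := by
    intro m
    have h1 : ENNReal.ofReal ‖T‖ ≤ (⌈‖T‖ / (δ / 2)⌉₊ : ℝ≥0∞) * ENNReal.ofReal (δ / 2) := by
      rw [← ENNReal.ofReal_natCast, ← ENNReal.ofReal_mul (Nat.cast_nonneg _)]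
      refine ENNReal.ofReal_le_ofReal ?_
      rw [← div_le_iff₀ (half_pos hδ)]
      exact Nat.le_ceil _
    refine le_trans (ENNReal.tsum_eq_iSup_sum.trans_le (iSup_le fun F => ?_)) h1
    simp only [← ofReal_norm]
    rw [← ENNReal.ofReal_sum_of_nonneg fun i _ => norm_nonneg _]
    refine ENNReal.ofReal_le_ofReal ((hx.sum_norm_apply_le (g m ∘L T) F).trans ?_)
    exact ((g m).opNorm_comp_le T).trans (mul_le_of_le_one_left (norm_nonneg _) (hg m))
  obtain ⟨φ, hφ, hφa⟩ := exists_injective_tsum_offDiag_le ENNReal.ofReal_ne_top _ _ hrow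
  obtain ⟨S, hS, -⟩ := (hx.comp hφ).exists_clm
  refine FixesCopyOfC0.of_bounded_below T S (half_pos hδ) fun c => ?_
  have hle : ∀ n, ‖c n‖ ≤ ‖c‖ := fun n => c.toBCF.norm_coe_le_norm n
  have key : ∀ m, ‖c m‖ * δ ≤ ‖T (S c)‖ + ‖c‖ * (δ / 2) := by
    intro m
    set ψ : StrongDual 𝕜 X := g (φ m) ∘L T
    have h1 : HasSum (fun n => c n * ψ (x (φ n))) (ψ (S c)) := by
      simpa using ψ.hasSum (hS c)
    have h3 : ‖ψ (S c) - c m * ψ (x (φ m))‖ ≤ ‖c‖ * (δ / 2) := by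
      have h4 := h1.tsum_eq
      rw [h1.summable.tsum_eq_add_tsum_ite m] at h4
      rw [← h4, add_sub_cancel_left]
      rw [← ENNReal.ofReal_le_ofReal_iff (by positivity), ofReal_norm]
      refine enorm_tsum_le_tsum_enorm.trans ?_
      calc ∑' n, ‖(if n = m then 0 else c n * ψ (x (φ n)))‖ₑ
          ≤ ∑' n, ENNReal.ofReal ‖c‖ * (if n = m then 0 else ‖g (φ m) (T (x (φ n)))‖ₑ) := by
            refine ENNReal.tsum_le_tsum fun n => ?_
            split_ifs
            · simp
            · rw [enorm_mul]
              gcongr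
              · rw [← ofReal_norm]; exact ENNReal.ofReal_le_ofReal (hle n)
              · exact le_rfl
        _ ≤ ENNReal.ofReal ‖c‖ * ENNReal.ofReal (δ / 2) := by
            rw [ENNReal.tsum_mul_left]
            gcongr
            exact hφa m
        _ = _ := (ENNReal.ofReal_mul (norm_nonneg _)).symm
    have h5 : ‖ψ (S c)‖ ≤ ‖T (S c)‖ :=
      ((g (φ m)).le_opNorm _).trans (mul_le_of_le_one_left (norm_nonneg _) (hg _))
    have h6 : ‖c m * ψ (x (φ m))‖ = ‖c m‖ * ‖T (x (φ m))‖ := by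
      rw [norm_mul, show ψ (x (φ m)) = _ from hgT (φ m), RCLike.norm_ofReal, abs_norm]
    calc ‖c m‖ * δ ≤ ‖c m‖ * ‖T (x (φ m))‖ := by gcongr; exact hT _
      _ = ‖ψ (S c) - (ψ (S c) - c m * ψ (x (φ m)))‖ := by rw [← h6, sub_sub_cancel]
      _ ≤ ‖ψ (S c)‖ + ‖ψ (S c) - c m * ψ (x (φ m))‖ := norm_sub_le _ _
      _ ≤ _ := add_le_add h5 h3
  have h7 : ‖c‖ ≤ (‖T (S c)‖ + ‖c‖ * (δ / 2)) / δ := by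
    rw [← ZeroAtInftyContinuousMap.norm_toBCF_eq_norm]
    refine (BoundedContinuousFunction.norm_le (by positivity)).2 fun m => ?_
    rw [ZeroAtInftyContinuousMap.norm_toBCF_eq_norm, le_div_iff₀ hδ]
    exact key m
  rw [le_div_iff₀ hδ] at h7
  linarith

/-! ### Failure of weak compactness and the two conclusions -/

theorem WeakDual.exists_mem_norm_sub_lt_of_mem_closure {𝕜 E : Type*} [RCLike 𝕜]
    [NormedAddCommGroup E] [NormedSpace 𝕜 E] {A : Set E}
    {ψ : WeakDual 𝕜 (StrongDual 𝕜 E)}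
    (hψ : ψ ∈ closure (inclusionInDoubleDualWeak 𝕜 E '' (toWeakSpace 𝕜 E '' A)))
    (ξ : StrongDual 𝕜 E) {ε : ℝ} (hε : 0 < ε) : ∃ a ∈ A, ‖ξ a - ψ ξ‖ < ε := by
  have hopen : IsOpen {χ : WeakDual 𝕜 (StrongDual 𝕜 E) | ‖χ ξ - ψ ξ‖ < ε} :=
    isOpen_lt ((WeakDual.eval_continuous ξ).sub continuous_const).norm continuous_const
  obtain ⟨_, hχ, _, ⟨a, ha, rfl⟩, rfl⟩ := mem_closure_iff.1 hψ _ hopen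
    (by simpa using hε)
  exact ⟨a, ha, hχ⟩

/-- A bounded set which is not relatively weakly compact has a weak-star cluster point in the
bidual outside the space. -/
theorem exists_mem_closure_of_not_isRelativelyWeaklyCompact {𝕜 E : Type*} [RCLike 𝕜]
    [NormedAddCommGroup E] [NormedSpace 𝕜 E] {A : Set E} (hb : Bornology.IsBounded A)
    (hA : ¬ IsRelativelyWeaklyCompact 𝕜 A) :
    ∃ ψ : WeakDual 𝕜 (StrongDual 𝕜 E),
      ψ ∈ closure (inclusionInDoubleDualWeak 𝕜 E '' (toWeakSpace 𝕜 E '' A)) ∧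
      ∀ x : E, WeakDual.toStrongDual ψ ≠ inclusionInDoubleDual 𝕜 E x := by
  by_contra! h
  refine hA (isCompact_closure_of_isBounded 𝕜 E _ ?_ fun ψ hψ => ?_)
  · rwa [Set.preimage_image_eq _ (toWeakSpace 𝕜 E).injective]
  · obtain ⟨x, hx⟩ := h ψ hψ
    exact ⟨toWeakSpace 𝕜 E x, hx.symm⟩

/-- A set of functionals that tends to zero uniformly along every weakly unconditionally Cauchy
sequence is bounded. -/
theorem isBounded_of_tendsto_iSup {𝕜 X : Type*} [RCLike 𝕜] [NormedAddCommGroup X]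
    [NormedSpace 𝕜 X] {A : Set (StrongDual 𝕜 X)}
    (hA : ∀ x : ℕ → X, IsWeaklyUnconditionallyCauchy 𝕜 x →
      Tendsto (fun n => ⨆ f ∈ A, ‖f (x n)‖ₑ) atTop (𝓝 0)) : Bornology.IsBounded A := by
  by_contra hnb
  have h1 : ∀ n : ℕ, ∃ f ∈ A, ∃ x : X, ‖x‖ < 1 ∧ (2 : ℝ) ^ n < ‖f x‖ := by
    intro n
    by_contra! h
    refine hnb (isBounded_iff_forall_norm_le.2 ⟨2 ^ n, fun f hf => ?_⟩)
    by_contra! hlt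
    obtain ⟨x, hx, hfx⟩ := f.exists_lt_apply_of_lt_opNorm hlt
    exact (h f hf x hx).not_gt hfx
  choose f hf x hx hfx using h1
  -- The scaled sequence is absolutely summable, yet `f n` exceeds `1` at its `n`-th term.
  have h2 := hA (fun n => ((2 : 𝕜) ^ n)⁻¹ • x n) fun g => by
    refine Summable.of_nonneg_of_le (fun _ => norm_nonneg _) (fun n => ?_)
      (summable_geometric_two.mul_left ‖g‖)
    rw [map_smul, norm_smul, norm_inv, norm_pow, RCLike.norm_ofNat, mul_comm, one_div, inv_pow]
    gcongr
    exact g.unit_le_opNorm _ (hx n).le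
  obtain ⟨n, hn⟩ := (h2.eventually_lt_const zero_lt_one).exists
  refine hn.not_ge (le_trans ?_ (le_iSup₂ (f := fun f (_ : f ∈ A) =>
    ‖f (((2 : 𝕜) ^ n)⁻¹ • x n)‖ₑ) (f n) (hf n)))
  rw [map_smul, ← ofReal_norm, ← ENNReal.ofReal_one, norm_smul, norm_inv, norm_pow,
    RCLike.norm_ofNat]
  refine ENNReal.ofReal_le_ofReal ?_
  rw [← div_eq_inv_mul, one_le_div (by positivity)]
  exact (hfx n).le

theorem IsMIdealInBidual.hasPropertyV {𝕜 X : Type*} [RCLike 𝕜] [NormedAddCommGroup X]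
    [NormedSpace 𝕜 X] (hX : IsMIdealInBidual 𝕜 X) : HasPropertyV 𝕜 X := by
  intro A hA
  by_contra hnot
  obtain ⟨ψ, hψ, hψJ⟩ := exists_mem_closure_of_not_isRelativelyWeaklyCompact
    (isBounded_of_tendsto_iSup hA) hnot
  obtain ⟨_, ⟨f, rfl⟩, g, hg, hfg⟩ := Submodule.mem_sup.1 (hX.1.sup_eq_top ▸ Submodule.mem_top :
    WeakDual.toStrongDual ψ ∈ dualInThirdDual 𝕜 X ⊔ annihilatorInThirdDual 𝕜 X)
  have hg0 : ‖g‖ ≠ 0 := fun h => hψJ f (by rw [← hfg, norm_eq_zero.1 h, add_zero]; rfl)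
  obtain ⟨z, hz, hgz⟩ := g.exists_lt_apply_of_lt_opNorm
    (half_lt_self ((norm_nonneg g).lt_of_ne' hg0))
  have hgz0 : 0 < ‖g z‖ := (half_pos ((norm_nonneg g).lt_of_ne' hg0)).trans hgz
  obtain ⟨x, hx, hxb⟩ := hX.exists_seq hz (B := (fun a => a - f) '' A) (δ := ‖g z‖ / 2)
    fun u => by
      set w := z - inclusionInDoubleDual 𝕜 X u
      obtain ⟨a, ha, haw⟩ := WeakDual.exists_mem_norm_sub_lt_of_mem_closure hψ w (half_pos hgz0)
      refine ⟨_, ⟨a, ha, rfl⟩, ?_⟩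
      -- Since `g` kills `X`, the value `g z` does not depend on `u`; approximating `ψ` at `w` costs
      -- half of it.
      have h1 : ψ w = w f + g z := by
        have h2 := DFunLike.congr_fun hfg w
        have h3 : g w = g z := by rw [map_sub, hg u, sub_zero]
        rw [← h3]
        exact h2.symm
      have h4 : g z = w (a - f) - (w a - ψ w) := by rw [h1, map_sub]; ring
      have h5 := norm_sub_le (w (a - f)) (w a - ψ w)
      rw [← h4] at h5
      linarith
  have h1 := hA x hx.isWeaklyUnconditionallyCauchy
  -- The single functional `f` is negligible along the sequence, so a lower bound for `a - f`
  -- contradicts the smallness of `A`.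
  have h2 : Tendsto (fun n => ‖f (x n)‖) atTop (𝓝 0) :=
    (hx.isWeaklyUnconditionallyCauchy f).tendsto_atTop_zero
  obtain ⟨n, hn1, hn2⟩ := ((h1.eventually_lt_const (ENNReal.ofReal_pos.2
    (show 0 < ‖g z‖ / 4 by positivity))).and
    (h2.eventually_lt_const (show 0 < ‖g z‖ / 4 by positivity))).exists
  obtain ⟨_, ⟨a, ha, rfl⟩, hab⟩ := hxb n
  have h3 := (le_iSup₂ (f := fun f (_ : f ∈ A) => ‖f (x n)‖ₑ) a ha).trans_lt hn1
  rw [← ofReal_norm, ENNReal.ofReal_lt_ofReal_iff (by positivity)] at h3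
  have h4 : ‖a (x n) - f (x n)‖ ≤ ‖a (x n)‖ + ‖f (x n)‖ := norm_sub_le _ _
  have h5 : ‖g z‖ / 2 ≤ ‖a (x n) - f (x n)‖ := hab
  linarith

/-- The second adjoint of an operator which is not weakly compact takes a value outside the
canonical copy of the target space. -/
theorem exists_comp_ne_of_not_isWeaklyCompactOperator {𝕜 X Y : Type*} [RCLike 𝕜]
    [NormedAddCommGroup X] [NormedSpace 𝕜 X] [NormedAddCommGroup Y] [NormedSpace 𝕜 Y]
    (T : X →L[𝕜] Y) (hT : ¬ IsWeaklyCompactOperator T) :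
    ∃ z : StrongDual 𝕜 (StrongDual 𝕜 X), ∀ y : Y,
      z ∘L (ContinuousLinearMap.compL 𝕜 X Y 𝕜).flip T ≠ inclusionInDoubleDual 𝕜 Y y := by
  have hb : Bornology.IsBounded (T '' Metric.closedBall 0 1) :=
    T.lipschitz.isBounded_image Metric.isBounded_closedBall
  obtain ⟨ψ, hψ, hψJ⟩ := exists_mem_closure_of_not_isRelativelyWeaklyCompact hb hT
  -- The second adjoint is weak-star continuous, so by Banach–Alaoglu the image of the bidual ball
  -- is closed and contains `ψ`.
  let Θ : WeakDual 𝕜 (StrongDual 𝕜 X) → WeakDual 𝕜 (StrongDual 𝕜 Y) := fun z =>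
    StrongDual.toWeakDual (WeakDual.toStrongDual z ∘L (ContinuousLinearMap.compL 𝕜 X Y 𝕜).flip T)
  have hΘ : Continuous Θ := WeakDual.continuous_of_continuous_eval fun f =>
    WeakDual.eval_continuous (f ∘L T)
  have hclosed : IsClosed (Θ '' (WeakDual.toStrongDual ⁻¹' Metric.closedBall 0 1)) :=
    ((WeakDual.isCompact_closedBall 0 1).image hΘ).isClosed
  have hsub : inclusionInDoubleDualWeak 𝕜 Y '' (toWeakSpace 𝕜 Y '' (T '' Metric.closedBall 0 1))
      ⊆ Θ '' (WeakDual.toStrongDual ⁻¹' Metric.closedBall 0 1) := by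
    rintro _ ⟨_, ⟨_, ⟨x, hx, rfl⟩, rfl⟩, rfl⟩
    refine ⟨StrongDual.toWeakDual (inclusionInDoubleDual 𝕜 X x), ?_, rfl⟩
    rw [Set.mem_preimage, mem_closedBall_zero_iff] at *
    exact (double_dual_bound 𝕜 X x).trans hx
  obtain ⟨z, -, rfl⟩ := hclosed.closure_subset_iff.2 hsub hψ
  exact ⟨WeakDual.toStrongDual z, hψJ⟩

theorem IsMIdealInBidual.fixesCopyOfC0 {𝕜 X Y : Type*} [RCLike 𝕜] [NormedAddCommGroup X]
    [NormedSpace 𝕜 X] [CompleteSpace X] [NormedAddCommGroup Y] [NormedSpace 𝕜 Y] [CompleteSpace Y]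
    (hX : IsMIdealInBidual 𝕜 X) (T : X →L[𝕜] Y) (hT : ¬ IsWeaklyCompactOperator T) :
    FixesCopyOfC0 T := by
  obtain ⟨z₀, hz₀⟩ := exists_comp_ne_of_not_isWeaklyCompactOperator T hT
  set T' : StrongDual 𝕜 Y →L[𝕜] StrongDual 𝕜 X := (ContinuousLinearMap.compL 𝕜 X Y 𝕜).flip T
  set c : ℝ := ‖z₀‖ + 1
  have hc : 0 < c := by positivity
  have hc' : (c : 𝕜) ≠ 0 := RCLike.ofReal_ne_zero.2 hc.ne'
  set z := (c : 𝕜)⁻¹ • z₀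
  have hz : ‖z‖ < 1 := by
    rw [norm_smul, norm_inv, RCLike.norm_ofReal, abs_of_pos hc, inv_mul_lt_iff₀ hc]
    simp [c]
  have hclosed : IsClosed (Set.range (inclusionInDoubleDual 𝕜 Y)) :=
    (inclusionInDoubleDualLi (E := Y) 𝕜).isometry.isClosedEmbedding.isClosed_range
  have hmem : z ∘L T' ∉ Set.range (inclusionInDoubleDual 𝕜 Y) := by
    rintro ⟨y, hy⟩
    refine hz₀ ((c : 𝕜) • y) ?_
    rw [map_smul, hy]
    ext f
    simp [z, hc']
  set d := Metric.infDist (z ∘L T') (Set.range (inclusionInDoubleDual 𝕜 Y))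
  have hd : 0 < d := (hclosed.notMem_iff_infDist_pos (Set.range_nonempty _)).1 hmem
  obtain ⟨x, hx, hxb⟩ := hX.exists_seq hz (B := T' '' Metric.closedBall 0 1) (δ := d / 2)
    fun u => by
      -- The second adjoint maps `u` to `T u`, so this norm is a distance from `z ∘L T'` to a point
      -- of `Y`.
      have h1 : d ≤ ‖(z - inclusionInDoubleDual 𝕜 X u) ∘L T'‖ := by
        have h2 := Metric.infDist_le_dist_of_mem (x := z ∘L T')
          (Set.mem_range_self (f := inclusionInDoubleDual 𝕜 Y) (T u))
        rw [dist_eq_norm] at h2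
        exact h2
      obtain ⟨f, hf, hfd⟩ := ContinuousLinearMap.exists_lt_apply_of_lt_opNorm _
        ((half_lt_self hd).trans_le h1)
      exact ⟨_, ⟨f, by simpa using hf.le, rfl⟩, hfd.le⟩
  refine hx.fixesCopyOfC0 T (half_pos hd) fun n => ?_
  obtain ⟨_, ⟨f, hf, rfl⟩, hfn⟩ := hxb n
  exact hfn.trans ((f.le_opNorm _).trans
    (mul_le_of_le_one_left (norm_nonneg _) (by simpa using hf)))

theorem theorem1 {𝕜 : Type*} [RCLike 𝕜]
    {X : Type*} [NormedAddCommGroup X] [NormedSpace 𝕜 X] [CompleteSpace X]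
    (hX : IsMIdealInBidual 𝕜 X) :
    HasPropertyV 𝕜 X ∧
    ∀ (Y : Type*) [NormedAddCommGroup Y] [NormedSpace 𝕜 Y] [CompleteSpace Y]
      (T : X →L[𝕜] Y), ¬ IsWeaklyCompactOperator T → FixesCopyOfC0 T := by
  exact ⟨hX.hasPropertyV, fun Y _ _ _ T hT => hX.fixesCopyOfC0 T hT⟩
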